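/- Let $R$ be a commutative Noetherian ring, $\mathfrak a$ a proper ideal of $R$ and $M$ a finitely generated $R$-module which is relative Cohen–Macaulay with respect to $\mathfrak a$, that is, exactly one of the local cohomology modules $H^i_{\mathfrak a}(M)$, $i\ge 0$, is non-zero. Let $n=\operatorname{cd}(\mathfrak a,M)$ be the largest integer $i$ with $H^i_{\mathfrak a}(M)\neq 0$. Here $V(\mathfrak a)$ is the set of prime ideals containing $\mathfrak a$, and, for a prime ideal $\mathfrak p$, $\mu^i(\mathfrak p,M)=\dim_{k(\mathfrak p)}\operatorname{Ext}^i_{R_{\mathfrak p}}(k(\mathfrak p),M_{\mathfrak p})$ with $k(\mathfrak p)=R_{\mathfrak p}/\mathfrak pR_{\mathfrak p}$; let $E(R/\mathfrak p)$ be the injective hull of $R/\mathfrak p$, and write $\mu E$ for the direct sum of $\mu$ copies of $E$. Then $H^n_{\mathfrak a}(M)$ has a minimal injective resolution of the form $$0\longrightarrow H^n_{\mathfrak a}(M)\longrightarrow\bigoplus_{\mathfrak p\in V(\mathfrak a)}\mu^{n}(\mathfrak p,M)\,E(R/\mathfrak p)\longrightarrow\bigoplus_{\mathfrak p\in V(\mathfrak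 a)}\mu^{n+1}(\mathfrak p,M)\,E(R/\mathfrak p)\longrightarrow\cdots,$$ i.e. it has a minimal injective resolution whose term in degree $j$ is isomorphic to $\bigoplus_{\mathfrak p\in V(\mathfrak a)}\mu^{n+j}(\mathfrak p,M)\,E(R/\mathfrak p)$ for every $j\ge 0$. Furthermore, $\operatorname{Ass}_R H^n_{\mathfrak a}(M)=\{\mathfrak p\in V(\mathfrak a):\mu^n(\mathfrak p,M)\neq 0\}$. -/

import Mathlib

open CategoryTheory

universe u

namespace RelativeCM

/-! ### Local cohomology as the right derived functors of the torsion functor -/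

section LocalCohomology

variable {R : Type u} [CommRing R]

/-- `Γ_a(M) = {x ∈ M | a ^ t x = 0 for some t}`. -/
def gamma (a : Ideal R) (M : Type u) [AddCommGroup M] [Module R M] : Submodule R M where
  carrier := {x | ∃ t : ℕ, ∀ r ∈ a ^ t, r • x = 0}
  zero_mem' := ⟨0, fun r _ => smul_zero r⟩
  add_mem' := by
    rintro x y ⟨s, hs⟩ ⟨t, ht⟩
    refine ⟨s + t, fun r hr => ?_⟩
    rw [smul_add, hs r (Ideal.pow_le_pow_right (Nat.le_add_right s t) hr),
      ht r (Ideal.pow_le_pow_right (Nat.le_add_left t s) hr), add_zero]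
  smul_mem' := by
    rintro c x ⟨t, ht⟩
    exact ⟨t, fun r hr => by rw [smul_comm, ht r hr, smul_zero]⟩

/-- The map `Γ_a(M) → Γ_a(N)` obtained by restricting a linear map `f : M → N`. -/
def gammaMap (a : Ideal R) {M N : Type u} [AddCommGroup M] [Module R M] [AddCommGroup N]
    [Module R N] (f : M →ₗ[R] N) : gamma a M →ₗ[R] gamma a N :=
  f.restrict (by
    rintro x ⟨t, ht⟩
    exact ⟨t, fun r hr => by rw [← map_smul, ht r hr, map_zero]⟩)

/-- The `a`-torsion functor `Γ_a` on the category of `R`-modules. -/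
def gammaFunctor (a : Ideal R) : ModuleCat.{u} R ⥤ ModuleCat.{u} R where
  obj M := ModuleCat.of R (gamma a M)
  map f := ModuleCat.ofHom (gammaMap a f.hom)
  map_id _ := rfl
  map_comp _ _ := rfl

instance (a : Ideal R) : (gammaFunctor a).Additive where
  map_add := rfl

/-- The local cohomology module `H^i_a(M)`: the value at `M` of the `i`-th right derived functor
of `Γ_a`. -/
noncomputable def localCohomologyModule (a : Ideal R) (i : ℕ) (M : Type u) [AddCommGroup M]
    [Module R M] : ModuleCat.{u} R :=
  ((gammaFunctor a).rightDerived i).obj (ModuleCat.of R M)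

/-- The set of all `i` with `H^i_a(M) ≠ 0`. -/
def nonvanishingDegrees (a : Ideal R) (M : Type u) [AddCommGroup M] [Module R M] : Set ℕ :=
  {i | Nontrivial (localCohomologyModule a i M)}

/-- `n = cd(a, M)`: the integer `n` is the largest one with `H^n_a(M) ≠ 0`. -/
def IsCohomologicalDimension (a : Ideal R) (M : Type u) [AddCommGroup M] [Module R M]
    (n : ℕ) : Prop :=
  IsGreatest (nonvanishingDegrees a M) n

/-- `M` is relative Cohen–Macaulay with respect to `a`: it is finitely generated, and precisely
one of its local cohomology modules with respect to `a` is non-zero. -/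
structure IsRelativeCohenMacaulay (a : Ideal R) (M : Type u) [AddCommGroup M]
    [Module R M] : Prop where
  finite : Module.Finite R M
  existsUnique : ∃! i : ℕ, i ∈ nonvanishingDegrees a M

end LocalCohomology

/-! ### Essential submodules and injective hulls -/

section InjectiveHull

/-- A submodule is essential if it meets every non-zero submodule non-trivially. -/
def IsEssential {R : Type*} [Ring R] {E : Type*} [AddCommGroup E] [Module R E]
    (N : Submodule R E) : Prop :=
  ∀ K : Submodule R E, K ⊓ N = ⊥ → K = ⊥

variable {R : Type u} [CommRing R]

/-- `f : N → E` is an injective hull (injective envelope) of `N`: `E` is injective and `f` is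
injective with essential image. -/
structure IsInjectiveHull {N E : Type u} [AddCommGroup N] [Module R N] [AddCommGroup E]
    [Module R E] (f : N →ₗ[R] E) : Prop where
  module_injective : Module.Injective R E
  injective : Function.Injective f
  essential : IsEssential (LinearMap.range f)

variable (R)

theorem exists_isInjectiveHull (N : Type u) [AddCommGroup N] [Module R N] :
    ∃ (E : ModuleCat.{u} R) (f : N →ₗ[R] E), IsInjectiveHull f := by
  -- embed `N` in an injective module `Q`
  let Q : ModuleCat.{u} R := Injective.under (ModuleCat.of R N)
  let j : N →ₗ[R] Q := (Injective.ι (ModuleCat.of R N)).hom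
  have hj : Function.Injective j := (ModuleCat.mono_iff_injective _).1 inferInstance
  have hQ : Module.Injective R Q :=
    (Module.injective_iff_injective_object R Q).2
      (inferInstanceAs (Injective (Injective.under (ModuleCat.of R N))))
  -- a maximal essential extension `K` of `j(N)` inside `Q`
  let S : Set (Submodule R Q) :=
    {K | LinearMap.range j ≤ K ∧ ∀ L ≤ K, L ⊓ LinearMap.range j = ⊥ → L = ⊥}
  have hS : LinearMap.range j ∈ S :=
    ⟨le_rfl, fun L hL h => by rwa [inf_eq_left.2 hL] at h⟩
  obtain ⟨K, -, hK⟩ := zorn_le_nonempty₀ S (by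
    intro c hc hchain y hy
    refine ⟨sSup c, ⟨(hc hy).1.trans (le_sSup hy), fun L hL h => ?_⟩, fun z hz => le_sSup hz⟩
    rw [Submodule.eq_bot_iff]
    intro x hx
    obtain ⟨z, hz, hxz⟩ :=
      (Submodule.mem_sSup_of_directed ⟨y, hy⟩ hchain.directedOn).1 (hL hx)
    have h1 : Submodule.span R {x} = ⊥ :=
      (hc hz).2 _ ((Submodule.span_singleton_le_iff_mem _ _).2 hxz)
        (eq_bot_iff.2 ((inf_le_inf_right _
          ((Submodule.span_singleton_le_iff_mem _ _).2 hx)).trans h.le))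
    exact Submodule.span_singleton_eq_bot.1 h1) _ hS
  -- a submodule `C` maximal with `C ⊓ K = ⊥`
  obtain ⟨C, -, hC⟩ := zorn_le_nonempty₀ {C : Submodule R Q | C ⊓ K = ⊥} (by
    intro c hc hchain y hy
    refine ⟨sSup c, ?_, fun z hz => le_sSup hz⟩
    change sSup c ⊓ K = ⊥
    rw [Submodule.eq_bot_iff]
    rintro x ⟨hx, hxK⟩
    obtain ⟨z, hz, hxz⟩ := (Submodule.mem_sSup_of_directed ⟨y, hy⟩ hchain.directedOn).1 hx
    exact (Submodule.eq_bot_iff _).1 (hc hz) x ⟨hxz, hxK⟩) ⊥ (bot_inf_eq K)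
  have hCK : C ⊓ K = ⊥ := hC.prop
  -- extend the inclusion of `K` along the injection of `K` into `Q ⧸ C`
  let i : K →ₗ[R] Q ⧸ C := C.mkQ ∘ₗ K.subtype
  have hi : Function.Injective i := by
    rw [← LinearMap.ker_eq_bot, Submodule.eq_bot_iff]
    intro x hx
    have hxC : (x : Q) ∈ C := (Submodule.Quotient.mk_eq_zero C).1 hx
    exact Subtype.ext ((Submodule.eq_bot_iff _).1 hCK _ ⟨hxC, x.2⟩)
  obtain ⟨g, hg⟩ := hQ.out i hi K.subtype
  -- the composite `r : Q → Q` restricts to the identity on `K`, and its kernel is `C`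
  let r : Q →ₗ[R] Q := g ∘ₗ C.mkQ
  have hr : ∀ x ∈ K, r x = x := fun x hx => hg ⟨x, hx⟩
  have hker : LinearMap.ker r = C := by
    refine (hC.eq_of_le ?_ ?_).symm
    · change LinearMap.ker r ⊓ K = ⊥
      rw [Submodule.eq_bot_iff]
      rintro x ⟨hx, hxK⟩
      rw [← hr x hxK]
      exact hx
    · intro x hx
      change g (C.mkQ x) = 0
      rw [Submodule.mkQ_apply, (Submodule.Quotient.mk_eq_zero C).2 hx, map_zero]
  -- the range of `r` is an essential extension of `K`, so it is `K`
  have hKr : K ≤ LinearMap.range r := fun x hx => ⟨x, hr x hx⟩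
  have hrange : LinearMap.range r ∈ S := by
    refine ⟨hK.prop.1.trans hKr, fun L hL h => ?_⟩
    have hLK : L ⊓ K = ⊥ := by
      refine hK.prop.2 _ inf_le_right (eq_bot_iff.2 ?_)
      exact (inf_le_inf_right _ inf_le_left).trans h.le
    have hcomap : L.comap r ≤ C := by
      refine hC.le_of_ge ?_ ?_
      · change L.comap r ⊓ K = ⊥
        rw [Submodule.eq_bot_iff]
        rintro x ⟨hx, hxK⟩
        refine (Submodule.eq_bot_iff _).1 hLK x ⟨?_, hxK⟩
        rw [← hr x hxK]
        exact hx
      · rw [← hker]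
        intro x hx
        change r x ∈ L
        rw [LinearMap.mem_ker.1 hx]
        exact L.zero_mem
    rw [Submodule.eq_bot_iff]
    intro x hx
    obtain ⟨y, rfl⟩ := hL hx
    have : y ∈ LinearMap.ker r := by rw [hker]; exact hcomap hx
    exact this
  have hrK : ∀ x, r x ∈ K := fun x => hK.le_of_ge hrange hKr ⟨x, rfl⟩
  refine ⟨ModuleCat.of R K, j.codRestrict K fun x => hK.prop.1 ⟨x, rfl⟩, ⟨⟨?_⟩, ?_, ?_⟩⟩
  · intro X Y _ _ _ _ f hf φ
    obtain ⟨ψ, hψ⟩ := hQ.out f hf (K.subtype ∘ₗ φ)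
    refine ⟨r.codRestrict K hrK ∘ₗ ψ, fun x => Subtype.ext ?_⟩
    change r (ψ (f x)) = φ x
    rw [hψ x]
    exact hr _ (φ x).2
  · intro x y hxy
    exact hj (congrArg Subtype.val hxy)
  · intro (L : Submodule R K) hL
    have h := hK.prop.2 (L.map K.subtype) (Submodule.map_subtype_le K L) (by
      rw [Submodule.eq_bot_iff]
      rintro _ ⟨⟨y, hy, rfl⟩, ⟨z, hz⟩⟩
      have : y ∈ (⊥ : Submodule R K) := by
        rw [← hL]
        exact ⟨hy, z, Subtype.ext hz⟩
      rw [(Submodule.mem_bot R).1 this, map_zero])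
    exact (Submodule.map_injective_of_injective K.injective_subtype) (h.trans (Submodule.map_bot _).symm)

/-- The injective hull `E(N)` of an `R`-module `N`. -/
noncomputable def injectiveHull (N : Type u) [AddCommGroup N] [Module R N] : ModuleCat.{u} R :=
  (exists_isInjectiveHull R N).choose

/-- The embedding `N → E(N)`. -/
noncomputable def toInjectiveHull (N : Type u) [AddCommGroup N] [Module R N] :
    N →ₗ[R] injectiveHull R N :=
  (exists_isInjectiveHull R N).choose_spec.choose

theorem isInjectiveHull_toInjectiveHull (N : Type u) [AddCommGroup N] [Module R N] :
    IsInjectiveHull (toInjectiveHull R N) :=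
  (exists_isInjectiveHull R N).choose_spec.choose_spec

variable {R}

/-- An injective resolution `0 → Z → I⁰ → I¹ → ⋯` is minimal if `ker (I^j → I^(j+1))` is essential
in `I^j` for every `j ≥ 0`. By exactness this kernel is the image of `Z` (for `j = 0`) or of
`I^(j-1)` (for `j ≥ 1`), so the condition says that `I^j` is the injective hull of that image. -/
def IsMinimalInjectiveResolution {Z : ModuleCat.{u} R} (I : InjectiveResolution Z) : Prop :=
  ∀ j : ℕ, IsEssential (LinearMap.ker (I.cocomplex.d j (j + 1)).hom)

end InjectiveHull

/-! ### Bass numbers -/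

section Bass

open IsLocalRing

/-- Over a local ring `S` with residue field `k`, the `S`-module `Ext^i_S(k, N)`. -/
abbrev residueExt (S : Type u) [CommRing S] [IsLocalRing S] (i : ℕ) (N : Type u) [AddCommGroup N]
    [Module S N] : Type u :=
  Abelian.Ext.{u} (ModuleCat.of S (ResidueField S)) (ModuleCat.of S N) i

theorem residueExt_isTorsionBySet (S : Type u) [CommRing S] [IsLocalRing S] (i : ℕ) (N : Type u)
    [AddCommGroup N] [Module S N] :
    Module.IsTorsionBySet S (residueExt S i N) (maximalIdeal S : Set S) := by
  rintro x ⟨r, hr⟩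
  change r • x = 0
  have h0 : r • 𝟙 (ModuleCat.of S (ResidueField S)) = 0 := by
    ext y
    change r • y = 0
    rw [Algebra.smul_def, ResidueField.algebraMap_eq, (residue_eq_zero_iff r).2 hr, zero_mul]
  calc r • x = r • (Abelian.Ext.mk₀ (𝟙 _)).comp x (zero_add i) := by
        rw [Abelian.Ext.mk₀_id_comp]
    _ = (Abelian.Ext.mk₀ (r • 𝟙 _)).comp x (zero_add i) := by
        rw [Abelian.Ext.mk₀_smul, Abelian.Ext.smul_comp]
    _ = 0 := by rw [h0, Abelian.Ext.mk₀_zero, Abelian.Ext.zero_comp]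

/-- `Ext^i_S(k, N)` is annihilated by the maximal ideal of `S`, so it is a vector space over the
residue field `k`. -/
noncomputable instance residueExtModule (S : Type u) [CommRing S] [IsLocalRing S] (i : ℕ)
    (N : Type u) [AddCommGroup N] [Module S N] :
    Module (ResidueField S) (residueExt S i N) :=
  (residueExt_isTorsionBySet S i N).module

/-- The Bass number `μ^i(p, M) = dim_{k(p)} Ext^i_{R_p}(k(p), M_p)`, as a cardinal. -/
noncomputable def bassNumber {R : Type u} [CommRing R] (i : ℕ) (p : PrimeSpectrum R) (M : Type u)
    [AddCommGroup M] [Module R M] : Cardinal.{u} :=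
  Module.rank (ResidueField (Localization.AtPrime p.asIdeal))
    (residueExt (Localization.AtPrime p.asIdeal) i (LocalizedModule p.asIdeal.primeCompl M))

/-- The module `⨁_{p ∈ V(a)} μ^i(p, M) E(R/p)`, where `μ E` is a direct sum of `μ` copies
of `E`. -/
abbrev bassSum {R : Type u} [CommRing R] (a : Ideal R) (i : ℕ) (M : Type u) [AddCommGroup M]
    [Module R M] : Type u :=
  DirectSum (PrimeSpectrum.zeroLocus (a : Set R))
    fun p => (bassNumber i p.1 M).out →₀ injectiveHull R (R ⧸ p.1.asIdeal)

end Bass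

end RelativeCM

/-! Let `E^•` be the minimal injective resolution of `M`, built from hulls of successive cosyzygies
`C^j`. The kernel of each differential of `Γ_a(E^•)` is essential. If `H^i_a(M) = 0` for `i < n`,
induction makes these differentials injective below degree `n`, so `Γ_a(E^j) = 0` there. Hence
`H^n_a(M)` is the kernel of `Γ_a(E^n) → Γ_a(E^(n+1))`, that is `Γ_a(C^n)`, and the vanishing above
`n` makes the rest exact: `Γ_a(E^•)` from degree `n` on is the required resolution.

Its terms are computed by `IsSocleFamily.nonempty_linearEquiv`. Bases of the socles of `N_p`, `p ∈
V(a)`, lift to elements of `N` with denominators cleared. The resulting maps `R/p → N` extend to a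
map from a sum of modules `E(R/p)` to the hull of `N`, which is injective with image exactly the
`a`-torsion. The number of copies is `μ^0(p, N)`, and dimension shifting
(`IsInjectiveHull.bassNumber_succ`) gives `μ^0(p, C^j) = μ^j(p, M)`. -/

namespace RelativeCM

/-! ### Prime annihilators, sums of injectives, and torsion in `E(R/p)`. -/

section Torsion

variable {R : Type u} [CommRing R]

theorem IsEssential.exists_smul_mem {E : Type*} [AddCommGroup E] [Module R E] {N : Submodule R E}
    (h : IsEssential N) {x : E} (hx : x ≠ 0) : ∃ r : R, r • x ∈ N ∧ r • x ≠ 0 := by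
  by_contra! hc
  refine hx (Submodule.span_singleton_eq_bot.1 (h (Submodule.span R {x}) ?_))
  rw [Submodule.eq_bot_iff]
  rintro y ⟨hy, hyN⟩
  obtain ⟨r, rfl⟩ := Submodule.mem_span_singleton.1 hy
  exact hc r hyN

theorem isEssential_of_exists_smul_mem {E : Type*} [AddCommGroup E] [Module R E]
    {N : Submodule R E} (h : ∀ x : E, x ≠ 0 → ∃ r : R, r • x ∈ N ∧ r • x ≠ 0) :
    IsEssential N := by
  intro K hK
  rw [Submodule.eq_bot_iff]
  intro x hx
  by_contra hx0
  obtain ⟨r, hr, hr0⟩ := h x hx0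
  exact hr0 ((Submodule.eq_bot_iff _).1 hK _ ⟨K.smul_mem r hx, hr⟩)

theorem IsInjectiveHull.exists_smul_eq {N E : Type u} [AddCommGroup N] [Module R N]
    [AddCommGroup E] [Module R E] {f : N →ₗ[R] E} (h : IsInjectiveHull f) {x : E} (hx : x ≠ 0) :
    ∃ (r : R) (y : N), f y = r • x ∧ r • x ≠ 0 := by
  obtain ⟨r, ⟨y, hy⟩, hr⟩ := h.essential.exists_smul_mem hx
  exact ⟨r, y, hy, hr⟩

/-- Every non-zero element of a module over a Noetherian ring has a multiple whose annihilator
is prime. -/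
theorem exists_smul_annihilator_prime [IsNoetherianRing R] {E : Type*} [AddCommGroup E]
    [Module R E] {x : E} (hx : x ≠ 0) :
    ∃ (r : R) (q : PrimeSpectrum R), ∀ s : R, s • r • x = 0 ↔ s ∈ q.asIdeal := by
  have : Nontrivial (Submodule.span R {x}) :=
    ⟨⟨x, Submodule.mem_span_singleton_self x⟩, 0, fun h => hx (congrArg Subtype.val h)⟩
  obtain ⟨q, hq⟩ := associatedPrimes.nonempty R (Submodule.span R {x})
  obtain ⟨hqp, ⟨y, hy⟩, hqy⟩ := isAssociatedPrime_iff.1 hq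
  obtain ⟨r, rfl⟩ := Submodule.mem_span_singleton.1 hy
  refine ⟨r, ⟨q, hqp⟩, fun s => ?_⟩
  change _ ↔ s ∈ q
  rw [hqy, Submodule.mem_colon_singleton, Submodule.mem_bot]
  exact (Submodule.mk_eq_zero _ _).symm

/-- Over a Noetherian ring, a direct sum of injective modules is injective. -/
theorem injective_directSum [IsNoetherianRing R] {ι : Type u} (E : ι → Type u)
    [∀ i, AddCommGroup (E i)] [∀ i, Module R (E i)] (h : ∀ i, Module.Injective R (E i)) :
    Module.Injective R (DirectSum ι E) := by
  classical
  refine Module.Baer.injective fun I g => ?_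
  obtain ⟨t, ht⟩ := (Module.Finite.fg_top : (⊤ : Submodule R I).FG)
  -- Outside `s` the components of `g` vanish on generators of `I`, so only finitely many
  -- coordinates need extending.
  let s : Finset ι := t.biUnion fun x => DFinsupp.support (g x)
  have hs : ∀ i ∉ s, DirectSum.component R ι E i ∘ₗ g = 0 := by
    intro i hi
    rw [← LinearMap.ker_eq_top, eq_top_iff, ← ht, Submodule.span_le]
    intro x hx
    by_contra hx0
    exact hi (Finset.mem_biUnion.2 ⟨x, hx, DFinsupp.mem_support_iff.2 hx0⟩)
  choose g' hg' using fun i => Module.Baer.of_injective (h i) I (DirectSum.component R ι E i ∘ₗ g)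
  refine ⟨∑ i ∈ s, DirectSum.lof R ι E i ∘ₗ g' i, fun x hx => ?_⟩
  refine DFinsupp.ext fun j => ?_
  have key : ∀ i, DirectSum.component R ι E j ((DirectSum.lof R ι E i) (g' i x)) =
      if i = j then DirectSum.component R ι E j (g ⟨x, hx⟩) else 0 := by
    intro i
    split_ifs with hij
    · subst hij
      rw [DirectSum.component.lof_self, hg' i x hx]
      rfl
    · rw [DirectSum.component.of, dif_neg hij]
  change DirectSum.component R ι E j _ = DirectSum.component R ι E j _
  simp only [LinearMap.sum_apply, LinearMap.comp_apply, map_sum, key, Finset.sum_ite_eq']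
  split_ifs with hj
  · rfl
  · exact (LinearMap.congr_fun (hs j hj) ⟨x, hx⟩).symm

section Hull

variable (p : PrimeSpectrum R)

theorem quotient_smul_eq_zero_iff {x : R ⧸ p.asIdeal} (hx : x ≠ 0) (s : R) :
    s • x = 0 ↔ s ∈ p.asIdeal := by
  rw [Algebra.smul_def, mul_eq_zero, or_iff_left hx, Ideal.Quotient.algebraMap_eq,
    Ideal.Quotient.eq_zero_iff_mem]

/-- If `x ∈ E(R/p)` is annihilated by the prime `q`, then up to a multiplier outside `q` it lies in
`R/p`, and it vanishes if `p ≠ q`. -/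
theorem exists_smul_mem_range_toInjectiveHull (q : PrimeSpectrum R)
    (x : injectiveHull R (R ⧸ p.asIdeal)) (hx : ∀ r ∈ q.asIdeal, r • x = 0) :
    ∃ t ∉ q.asIdeal, t • x ∈ LinearMap.range (toInjectiveHull R (R ⧸ p.asIdeal)) ∧
      (p ≠ q → t • x = 0) := by
  by_cases h : ∃ t ∉ q.asIdeal, t • x = 0
  · obtain ⟨t, ht, htx⟩ := h
    exact ⟨t, ht, htx ▸ zero_mem _, fun _ => htx⟩
  push Not at h
  have hx0 : x ≠ 0 := fun h0 => h 1 ((Ideal.ne_top_iff_one _).1 q.isPrime.ne_top) (by simp [h0])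
  obtain ⟨t, y, hy, ht⟩ := (isInjectiveHull_toInjectiveHull R (R ⧸ p.asIdeal)).exists_smul_eq hx0
  have htq : t ∉ q.asIdeal := fun h' => ht (hx t h')
  -- No multiplier outside `q` kills `x`, so `t • x` has annihilator `q`; as a nonzero element of
  -- `R/p` it also has annihilator `p`.
  refine ⟨t, htq, ⟨y, hy⟩, fun hpq => (hpq ?_).elim⟩
  have hy0 : y ≠ 0 := by
    rintro rfl
    exact ht (by rw [← hy, map_zero])
  ext s
  rw [← quotient_smul_eq_zero_iff p hy0,
    ← map_eq_zero_iff _ (isInjectiveHull_toInjectiveHull R (R ⧸ p.asIdeal)).injective, map_smul, hy]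
  constructor
  · intro hs
    by_contra hsq
    exact h (s * t) (fun h' => (q.isPrime.mem_or_mem h').elim hsq htq) (by rw [mul_smul, hs])
  · intro hs
    rw [smul_comm, hx s hs, smul_zero]

variable [IsNoetherianRing R] in
/-- Every element of `E(R/p)` is annihilated by a power of `p`. -/
theorem exists_pow_smul_injectiveHull_eq_zero (x : injectiveHull R (R ⧸ p.asIdeal)) :
    ∃ t : ℕ, ∀ r ∈ p.asIdeal ^ t, r • x = 0 := by
  suffices h : p.asIdeal ≤ (Ideal.torsionOf R _ x).radical by
    obtain ⟨t, ht⟩ := Ideal.exists_pow_le_of_le_radical_of_fg h (IsNoetherian.noetherian _)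
    exact ⟨t, fun r hr => (Ideal.mem_torsionOf_iff _ _).1 (ht hr)⟩
  intro r hr
  -- The annihilators of `r ^ k • x` stabilize. If `r ^ k • x ≠ 0`, a nonzero multiple of it by some
  -- `s` lies in `R/p` and is killed by `r`, so `s` shows the chain growing after `k`.
  let A : ℕ →o Ideal R := ⟨fun k => Ideal.torsionOf R _ (r ^ k • x), monotone_nat_of_le_succ (by
    intro k s hs
    rw [Ideal.mem_torsionOf_iff] at hs ⊢
    rw [pow_succ', mul_smul, smul_comm, hs, smul_zero])⟩
  obtain ⟨k, hk⟩ := monotone_stabilizes_iff_noetherian.2 ‹IsNoetherianRing R› A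
  refine ⟨k, (Ideal.mem_torsionOf_iff _ _).2 ?_⟩
  by_contra hne
  obtain ⟨s, y, hy, hs⟩ := (isInjectiveHull_toInjectiveHull R (R ⧸ p.asIdeal)).exists_smul_eq hne
  have hy0 : y ≠ 0 := by
    rintro rfl
    exact hs (by rw [← hy, map_zero])
  have h1 : r • s • r ^ k • x = 0 := by
    rw [← hy, ← map_smul, (quotient_smul_eq_zero_iff p hy0 r).2 hr, map_zero]
  have h2 : s ∈ A (k + 1) := by
    refine (Ideal.mem_torsionOf_iff _ _).2 ?_
    rw [pow_succ', mul_smul, smul_comm, h1]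
  rw [← hk (k + 1) (Nat.le_succ k)] at h2
  exact hs ((Ideal.mem_torsionOf_iff _ _).1 h2)

end Hull

end Torsion

end RelativeCM

namespace RelativeCM

/-! ### The `a`-torsion of an injective hull as a direct sum. -/

section Decomposition

variable {R : Type u} [CommRing R]

/-- A family `e` of elements of `N` such that the `e i` with `P i = q` lift, for every prime `q`
containing `a`, a basis of the space of elements of `N_q` annihilated by `q`. -/
structure IsSocleFamily (a : Ideal R) {N : Type u} [AddCommGroup N] [Module R N] {ι : Type u}
    (P : ι → PrimeSpectrum R) (e : ι → N) : Prop where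
  le : ∀ i, a ≤ (P i).asIdeal
  smul_eq_zero : ∀ i, ∀ r ∈ (P i).asIdeal, r • e i = 0
  independent : ∀ (q : PrimeSpectrum R) (c : ι →₀ R), (∀ i ∈ c.support, P i = q) →
    Finsupp.linearCombination R e c = 0 → ∀ i, c i ∈ q.asIdeal
  exists_smul_mem : ∀ (q : PrimeSpectrum R) (x : N), a ≤ q.asIdeal →
    (∀ r ∈ q.asIdeal, r • x = 0) → ∃ t ∉ q.asIdeal, t • x ∈ Submodule.span R (Set.range e)

variable {a : Ideal R} {N E : Type u} [AddCommGroup N] [Module R N] [AddCommGroup E] [Module R E]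
  {f : N →ₗ[R] E} {ι : Type u} {P : ι → PrimeSpectrum R} {e : ι → N}

/-- The extension to `E(R/P)` of the map `R/P → E` sending `1` to `f e`. -/
theorem IsInjectiveHull.exists_extend (hf : IsInjectiveHull f) (p : PrimeSpectrum R) (x : N)
    (hx : ∀ r ∈ p.asIdeal, r • x = 0) :
    ∃ ψ : injectiveHull R (R ⧸ p.asIdeal) →ₗ[R] E,
      ∀ r : R, ψ (toInjectiveHull R _ (Ideal.Quotient.mk p.asIdeal r)) = f (r • x) := by
  obtain ⟨ψ, hψ⟩ := hf.module_injective.out _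
    (isInjectiveHull_toInjectiveHull R (R ⧸ p.asIdeal)).injective
    (Submodule.liftQ p.asIdeal (f ∘ₗ LinearMap.toSpanSingleton R N x) (by
      intro r hr
      simp [hx r hr]))
  refine ⟨ψ, fun r => ?_⟩
  rw [hψ]
  rfl

theorem directSum_le_gamma [IsNoetherianRing R] (hP : ∀ i, a ≤ (P i).asIdeal)
    (φ : DirectSum ι (fun i => injectiveHull R (R ⧸ (P i).asIdeal)) →ₗ[R] E) :
    LinearMap.range φ ≤ gamma a E := by
  classical
  rintro _ ⟨x, rfl⟩
  induction x using DirectSum.induction_on with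
  | zero => rw [map_zero]; exact zero_mem _
  | add x y hx hy => rw [map_add]; exact add_mem hx hy
  | of i x =>
    obtain ⟨t, ht⟩ := exists_pow_smul_injectiveHull_eq_zero (P i) x
    refine ⟨t, fun r hr => ?_⟩
    change r • φ (DirectSum.lof R ι _ i x) = 0
    rw [← map_smul, ← map_smul, ht r (Ideal.pow_right_mono (hP i) t hr), map_zero, map_zero]

/-- Only finitely many coordinates are nonzero, and the product of their multipliers stays outside
the prime `q`. -/
theorem exists_smul_forall_mem [IsNoetherianRing R] (q : PrimeSpectrum R)
    (x : DirectSum ι (fun i => injectiveHull R (R ⧸ (P i).asIdeal)))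
    (hx : ∀ r ∈ q.asIdeal, r • x = 0) :
    ∃ t ∉ q.asIdeal, ∀ i, (t • x) i ∈ LinearMap.range (toInjectiveHull R (R ⧸ (P i).asIdeal)) ∧
      (P i ≠ q → (t • x) i = 0) := by
  classical
  choose t ht hmem hzero using fun i => exists_smul_mem_range_toInjectiveHull (P i) q (x i)
    (fun r hr => by rw [← DirectSum.smul_apply, hx r hr]; rfl)
  refine ⟨∏ i ∈ DFinsupp.support x, t i, fun h => ?_, fun i => ?_⟩
  · obtain ⟨i, -, hi⟩ := (q.isPrime.prod_mem_iff).1 h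
    exact ht i hi
  · rw [DirectSum.smul_apply]
    by_cases hi : i ∈ DFinsupp.support x
    · rw [← Finset.mul_prod_erase _ _ hi, mul_comm, mul_smul]
      exact ⟨Submodule.smul_mem _ _ (hmem i), fun h => by rw [hzero i h, smul_zero]⟩
    · rw [DFinsupp.notMem_support_iff.1 hi, smul_zero]
      exact ⟨zero_mem _, fun _ => rfl⟩

/-- A nonzero kernel contains an element with prime annihilator `q`. Up to a multiplier outside `q`,
its coordinates lie in the `R/P i` and vanish unless `P i = q`. Its image then gives a relation
among the `e i` with `P i = q`; independence puts the coefficients in `q`, so the element is zero.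
-/
theorem IsSocleFamily.injective [IsNoetherianRing R] (he : IsSocleFamily a P e)
    (hf : IsInjectiveHull f) (ψ : ∀ i, injectiveHull R (R ⧸ (P i).asIdeal) →ₗ[R] E)
    (hψ : ∀ i r, ψ i (toInjectiveHull R _ (Ideal.Quotient.mk _ r)) = f (r • e i)) [DecidableEq ι] :
    Function.Injective (DirectSum.toModule R ι E ψ) := by
  classical
  rw [← LinearMap.ker_eq_bot, Submodule.eq_bot_iff]
  intro x hx
  by_contra hx0
  obtain ⟨r, q, hq⟩ := exists_smul_annihilator_prime (R := R) hx0
  obtain ⟨t, ht, hmem⟩ := exists_smul_forall_mem q (r • x) (fun s hs => (hq s).2 hs)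
  set y := t • r • x with hy
  have hy0 : y ≠ 0 := fun h => ht ((hq t).1 h)
  have hφy : DirectSum.toModule R ι E ψ y = 0 := by
    rw [hy, map_smul, map_smul, LinearMap.mem_ker.1 hx, smul_zero, smul_zero]
  choose z hz using fun i => (hmem i).1
  choose c hc using fun i => Ideal.Quotient.mk_surjective (z i)
  -- Off the support of `y` the lifts `c i` are arbitrary elements of `P i`; truncation makes the
  -- family finitely supported.
  let c' : ι →₀ R := Finsupp.onFinset (DFinsupp.support y)
    (fun i => if i ∈ DFinsupp.support y then c i else 0) (fun i hi => by
      by_contra h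
      exact hi (if_neg h))
  have hc' : ∀ i ∈ DFinsupp.support y, c' i = c i := fun i hi => if_pos hi
  have hsub : c'.support ⊆ DFinsupp.support y := Finsupp.support_onFinset_subset
  have hsum : Finsupp.linearCombination R e c' = 0 := by
    refine (map_eq_zero_iff f hf.injective).1 ?_
    rw [← hφy, Finsupp.linearCombination_apply, Finsupp.sum_of_support_subset _ hsub _ (by simp),
      map_sum]
    conv_rhs => rw [← DirectSum.sum_support_of y, map_sum]
    refine Finset.sum_congr rfl fun i hi => ?_
    change _ = DirectSum.toModule R ι E ψ (DirectSum.lof R ι _ i (y i))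
    rw [DirectSum.toModule_lof, ← hz i, ← hc i, hψ, hc' i hi]
  have hcq := he.independent q c' (fun i hi => by
    by_contra h
    exact DFinsupp.mem_support_iff.1 (hsub hi) ((hmem i).2 h)) hsum
  refine hy0 (DFinsupp.ext fun i => ?_)
  by_contra hi
  have hiq : P i = q := by
    by_contra h
    exact hi ((hmem i).2 h)
  have := hcq i
  rw [hc' i (DFinsupp.mem_support_iff.2 hi), ← hiq] at this
  exact hi (by rw [← hz i, ← hc i, Ideal.Quotient.eq_zero_iff_mem.2 this, map_zero]; rfl)

/-- The `a`-torsion of an injective hull of `N` is the direct sum of the modules `E(R/P i)` where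
`P` is the family of primes of a socle family of `N`. -/
theorem IsSocleFamily.nonempty_linearEquiv [IsNoetherianRing R] (he : IsSocleFamily a P e)
    (hf : IsInjectiveHull f) :
    Nonempty (gamma a E ≃ₗ[R] DirectSum ι fun i => injectiveHull R (R ⧸ (P i).asIdeal)) := by
  classical
  choose ψ hψ using fun i => hf.exists_extend (P i) (e i) (he.smul_eq_zero i)
  let φ := DirectSum.toModule R ι E ψ
  have hφ : Function.Injective φ := he.injective hf ψ hψ
  have hle : LinearMap.range φ ≤ gamma a E := directSum_le_gamma he.le φ
  have hspan : ∀ x ∈ Submodule.span R (Set.range e), ∃ w, φ w = f x := by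
    intro x hx
    change x ∈ (LinearMap.range φ).comap f
    refine (Submodule.span_le.2 ?_) hx
    rintro _ ⟨i, rfl⟩
    refine ⟨DirectSum.lof R ι _ i (toInjectiveHull R _ (Ideal.Quotient.mk _ 1)), ?_⟩
    rw [DirectSum.toModule_lof, hψ, one_smul]
  have hinj := injective_directSum (fun i => injectiveHull R (R ⧸ (P i).asIdeal))
    fun i => (isInjectiveHull_toInjectiveHull R (R ⧸ (P i).asIdeal)).module_injective
  obtain ⟨ρ, hρ⟩ := hinj.out φ hφ LinearMap.id
  -- `ρ` is a retraction of `φ`, so surjectivity onto the torsion means that `z = y - φ (ρ y)`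
  -- vanishes.
  suffices hge : gamma a E ≤ LinearMap.range φ by
    exact ⟨((LinearEquiv.ofInjective φ hφ).trans (LinearEquiv.ofEq _ _ (hle.antisymm hge))).symm⟩
  intro y hy
  suffices h0 : y - φ (ρ y) = 0 from ⟨ρ y, (sub_eq_zero.1 h0).symm⟩
  obtain ⟨z, hz⟩ : ∃ z, z = y - φ (ρ y) := ⟨_, rfl⟩
  have hzγ : z ∈ gamma a E := hz ▸ sub_mem hy (hle ⟨_, rfl⟩)
  have hρz : ρ z = 0 := by rw [hz, map_sub, hρ, LinearMap.id_apply, sub_self]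
  rw [← hz]
  by_contra hz0
  obtain ⟨r, q, hq⟩ := exists_smul_annihilator_prime (R := R) hz0
  have haq : a ≤ q.asIdeal := by
    obtain ⟨t, ht⟩ := (gamma a E).smul_mem r hzγ
    exact q.isPrime.le_of_pow_le fun s hs => (hq s).1 (ht s hs)
  have hrz : r • z ≠ 0 := fun h => (Ideal.ne_top_iff_one _).1 q.isPrime.ne_top
    ((hq 1).1 (by rw [h, smul_zero]))
  -- A multiple `r' • r • z` comes from `x ∈ N` killed by `q`. Some `t ∉ q` moves it into the image
  -- of `φ`, where `ρ z = 0` forces it to be zero; but `t * r' ∉ q`.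
  obtain ⟨r', x, hx, hr'⟩ := hf.exists_smul_eq hrz
  have hr'q : r' ∉ q.asIdeal := fun h => hr' ((hq r').2 h)
  obtain ⟨t, ht, htx⟩ := he.exists_smul_mem q x haq (fun s hs => by
    refine (map_eq_zero_iff f hf.injective).1 ?_
    rw [map_smul, hx, smul_comm, (hq s).2 hs, smul_zero])
  obtain ⟨w, hw⟩ := hspan _ htx
  have hw0 : w = 0 := by
    have := hρ w
    rw [hw, map_smul, hx, map_smul, map_smul, map_smul, hρz, smul_zero, smul_zero, smul_zero] at this
    exact this.symm
  rw [hw0, map_zero, map_smul, hx, ← mul_smul] at hw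
  exact (q.isPrime.mem_or_mem ((hq _).1 hw.symm)).elim ht hr'q

theorem IsSocleFamily.injective_gamma [IsNoetherianRing R] (he : IsSocleFamily a P e)
    (hf : IsInjectiveHull f) : Module.Injective R (gamma a E) := by
  obtain ⟨l⟩ := he.nonempty_linearEquiv hf
  have hinj := injective_directSum (fun i => injectiveHull R (R ⧸ (P i).asIdeal))
    fun i => (isInjectiveHull_toInjectiveHull R (R ⧸ (P i).asIdeal)).module_injective
  exact ((Module.Baer.of_injective hinj).of_equiv l.symm).injective

end Decomposition

end RelativeCM

namespace RelativeCM

/-! ### Socles over a local ring and dimension shifting. -/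

section Socle

open IsLocalRing

/-- The elements of `N` annihilated by the maximal ideal of the local ring `S`. -/
abbrev socle (S : Type u) [CommRing S] [IsLocalRing S] (N : Type u) [AddCommGroup N] [Module S N] :
    Submodule S N :=
  Submodule.torsionBySet S N (maximalIdeal S : Set S)

noncomputable instance socleModule (S : Type u) [CommRing S] [IsLocalRing S] (N : Type u)
    [AddCommGroup N] [Module S N] : Module (ResidueField S) (socle S N) :=
  inferInstanceAs (Module (S ⧸ maximalIdeal S) (socle S N))

instance (S : Type u) [CommRing S] [IsLocalRing S] (N : Type u)
    [AddCommGroup N] [Module S N] : IsScalarTower S (ResidueField S) (socle S N) :=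
  (Submodule.torsionBySet_isTorsionBySet (maximalIdeal S : Set S)).isScalarTower

instance (S : Type u) [CommRing S] [IsLocalRing S] (i : ℕ) (N : Type u)
    [AddCommGroup N] [Module S N] : IsScalarTower S (ResidueField S) (residueExt S i N) :=
  (residueExt_isTorsionBySet S i N).isScalarTower

section Local

variable {S : Type u} [CommRing S] [IsLocalRing S]

theorem mem_socle {N : Type u} [AddCommGroup N] [Module S N] {x : N} :
    x ∈ socle S N ↔ ∀ r ∈ maximalIdeal S, r • x = 0 := by
  simp

theorem rank_residueField_eq {V W : Type u} [AddCommGroup V] [AddCommGroup W] [Module S V]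
    [Module S W] [Module (ResidueField S) V] [Module (ResidueField S) W]
    [IsScalarTower S (ResidueField S) V] [IsScalarTower S (ResidueField S) W] (e : V ≃ₗ[S] W) :
    Module.rank (ResidueField S) V = Module.rank (ResidueField S) W :=
  (e.extendScalarsOfSurjective residue_surjective).rank_eq

/-- Evaluation at `1` of a linear map from the residue field, as an element of the socle. -/
noncomputable def evalOne (N : Type u) [AddCommGroup N] [Module S N] :
    (ResidueField S →ₗ[S] N) →ₗ[S] socle S N where
  toFun g := ⟨g 1, mem_socle.2 fun r hr => by
    rw [← map_smul, Algebra.smul_def, ResidueField.algebraMap_eq, (residue_eq_zero_iff r).2 hr,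
      zero_mul, map_zero]⟩
  map_add' _ _ := rfl
  map_smul' _ _ := rfl

/-- A linear map from the residue field is determined by the image of `1`, an element annihilated
by the maximal ideal. -/
noncomputable def residueFieldHomEquiv (N : Type u) [AddCommGroup N] [Module S N] :
    (ResidueField S →ₗ[S] N) ≃ₗ[S] socle S N :=
  LinearEquiv.ofBijective (evalOne N) (by
    constructor
    · intro g h hgh
      ext x
      obtain ⟨r, rfl⟩ := residue_surjective x
      have : g 1 = h 1 := congrArg Subtype.val hgh
      rw [← mul_one (residue S r), ← ResidueField.algebraMap_eq, ← Algebra.smul_def, map_smul,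
        map_smul, this]
    · rintro ⟨x, hx⟩
      refine ⟨Submodule.liftQ (maximalIdeal S) (LinearMap.toSpanSingleton S N x) ?_,
        Subtype.ext ?_⟩
      · intro r hr
        exact mem_socle.1 hx r hr
      · change (1 : S) • x = x
        exact one_smul S x)

/-- `Ext^0(k, N)` is the socle of `N`. -/
noncomputable def residueExtZeroEquiv (N : Type u) [AddCommGroup N] [Module S N] :
    residueExt S 0 N ≃ₗ[S] socle S N :=
  Abelian.Ext.linearEquiv₀ ≪≫ₗ ModuleCat.homLinearEquiv ≪≫ₗ residueFieldHomEquiv N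

/-- Dimension shifting along a short exact sequence `0 → N → E → C → 0` with `E` injective such
that the socle of `E` maps to zero in `C`. -/
theorem nonempty_residueExt_succ_equiv {N E C : Type u} [AddCommGroup N] [Module S N]
    [AddCommGroup E] [Module S E] [AddCommGroup C] [Module S C] (f : N →ₗ[S] E) (g : E →ₗ[S] C)
    (hf : Function.Injective f) (hfg : Function.Exact f g) (hg : Function.Surjective g)
    (hE : Module.Injective S E) (hs : ∀ x ∈ socle S E, g x = 0) (i : ℕ) :
    Nonempty (residueExt S i C ≃ₗ[S] residueExt S (i + 1) N) := by
  let T : ShortComplex (ModuleCat.{u} S) :=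
    ShortComplex.mk (ModuleCat.ofHom f) (ModuleCat.ofHom g) (by
      ext x
      exact hfg.apply_apply_eq_zero x)
  have hT : T.ShortExact :=
    { exact := (ShortComplex.ShortExact.moduleCat_exact_iff_function_exact _).2 hfg
      mono_f := (ModuleCat.mono_iff_injective _).2 hf
      epi_g := (ModuleCat.epi_iff_surjective _).2 hg }
  have : Injective T.X₂ := (Module.injective_iff_injective_object S E).1 hE
  let k : ModuleCat.{u} S := ModuleCat.of S (ResidueField S)
  refine ⟨LinearEquiv.ofBijective
    (Abelian.Ext.postcompOfLinear hT.extClass S k (rfl : i + 1 = i + 1)) ⟨?_, ?_⟩⟩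
  · rw [← LinearMap.ker_eq_bot, Submodule.eq_bot_iff]
    intro x hx
    obtain ⟨y, rfl⟩ := Abelian.Ext.covariant_sequence_exact₃ k hT x rfl hx
    -- The kernel of the connecting map comes from `Ext^i(k, E)`. This is zero for `i > 0`; for `i =
    -- 0` a map `k → E` lands in the socle, which `g` kills.
    cases i with
    | succ i => rw [Abelian.Ext.eq_zero_of_injective y, Abelian.Ext.zero_comp]
    | zero =>
      obtain ⟨h, rfl⟩ := Abelian.Ext.addEquiv₀.symm.surjective y
      change (Abelian.Ext.mk₀ h).comp (Abelian.Ext.mk₀ T.g) _ = 0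
      rw [Abelian.Ext.mk₀_comp_mk₀]
      suffices h0 : h ≫ T.g = 0 by rw [h0, Abelian.Ext.mk₀_zero]
      ext1
      refine (residueFieldHomEquiv C).injective ?_
      rw [ModuleCat.hom_zero, map_zero]
      exact Subtype.ext (hs _ (residueFieldHomEquiv E h.hom).2)
  · intro x
    exact Abelian.Ext.covariant_sequence_exact₁ k hT x (Abelian.Ext.eq_zero_of_injective _) rfl

end Local

end Socle

/-! ### Socles of localizations and Bass numbers. -/

section Localize

open IsLocalRing

variable {R : Type u} [CommRing R] (p : PrimeSpectrum R)

/-- The localization `N_p`. -/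
abbrev atPrime (N : Type u) [AddCommGroup N] [Module R N] : Type u :=
  LocalizedModule p.asIdeal.primeCompl N

/-- The localization map `N → N_p`. -/
noncomputable abbrev toAtPrime (N : Type u) [AddCommGroup N] [Module R N] : N →ₗ[R] atPrime p N :=
  LocalizedModule.mkLinearMap p.asIdeal.primeCompl N

/-- The elements of `N_p` annihilated by `p`. -/
abbrev socleAt (N : Type u) [AddCommGroup N] [Module R N] :
    Submodule (Localization.AtPrime p.asIdeal) (atPrime p N) :=
  socle (Localization.AtPrime p.asIdeal) (atPrime p N)

variable {p} {N : Type u} [AddCommGroup N] [Module R N]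

theorem toAtPrime_eq_zero_iff {x : N} :
    toAtPrime p N x = 0 ↔ ∃ s ∉ p.asIdeal, s • x = 0 := by
  rw [IsLocalizedModule.eq_zero_iff p.asIdeal.primeCompl (toAtPrime p N)]
  exact ⟨fun ⟨s, hs⟩ => ⟨s.1, s.2, hs⟩, fun ⟨s, hs, h⟩ => ⟨⟨s, hs⟩, h⟩⟩

theorem smul_atPrime_eq_zero_iff {s : R} (hs : s ∉ p.asIdeal) {x : atPrime p N} :
    s • x = 0 ↔ x = 0 := by
  refine ⟨fun h => ?_, fun h => by rw [h, smul_zero]⟩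
  refine IsLocalizedModule.smul_injective (toAtPrime p N) (⟨s, hs⟩ : p.asIdeal.primeCompl) ?_
  change s • x = s • 0
  rw [h, smul_zero]

theorem mem_socleAt {x : atPrime p N} : x ∈ socleAt p N ↔ ∀ r ∈ p.asIdeal, r • x = 0 := by
  rw [mem_socle]
  constructor
  · intro h r hr
    rw [← algebraMap_smul (Localization.AtPrime p.asIdeal) r x]
    exact h _ ((IsLocalization.AtPrime.to_map_mem_maximal_iff _ p.asIdeal r).2 hr)
  · intro h r hr
    obtain ⟨b, s, rfl⟩ := IsLocalization.exists_mk'_eq p.asIdeal.primeCompl r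
    rw [← smul_atPrime_eq_zero_iff s.2, ← algebraMap_smul (Localization.AtPrime p.asIdeal) s.1,
      smul_smul, mul_comm, IsLocalization.mk'_spec, algebraMap_smul]
    exact h b ((IsLocalization.AtPrime.mk'_mem_maximal_iff _ p.asIdeal b s).1 hr)

/-- Each generator of `p` kills the numerator of `x` after a multiplier outside `p`; since `p` is
finitely generated, one product serves for all. -/
theorem exists_smul_eq_toAtPrime [IsNoetherianRing R] {x : atPrime p N} (hx : x ∈ socleAt p N) :
    ∃ s ∉ p.asIdeal, ∃ y : N, (∀ r ∈ p.asIdeal, r • y = 0) ∧ toAtPrime p N y = s • x := by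
  classical
  obtain ⟨⟨y, s⟩, hy⟩ := IsLocalizedModule.surj p.asIdeal.primeCompl (toAtPrime p N) x
  change (s : R) • x = _ at hy
  have h : ∀ r ∈ p.asIdeal, ∃ t ∉ p.asIdeal, t • r • y = 0 := fun r hr => by
    rw [← toAtPrime_eq_zero_iff, map_smul, ← hy, smul_comm, mem_socleAt.1 hx r hr, smul_zero]
  obtain ⟨T, hT⟩ := IsNoetherian.noetherian p.asIdeal
  have hTp : ∀ r ∈ T, r ∈ p.asIdeal := fun r hr => hT ▸ Submodule.subset_span hr
  choose! t ht hty using h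
  let t' := ∏ r ∈ T, t r
  have ht' : t' ∉ p.asIdeal := fun h => by
    obtain ⟨r, hr, h⟩ := (p.isPrime.prod_mem_iff).1 h
    exact ht r (hTp r hr) h
  refine ⟨t' * s, fun h => (p.isPrime.mem_or_mem h).elim ht' s.2, t' • y, ?_, ?_⟩
  · suffices hle : p.asIdeal ≤ Ideal.torsionOf R N (t' • y) from
      fun r hr => (Ideal.mem_torsionOf_iff _ _).1 (hle hr)
    rw [← hT, Submodule.span_le]
    intro r hr
    refine (Ideal.mem_torsionOf_iff _ _).2 ?_
    rw [smul_comm]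
    change (∏ r ∈ T, t r) • r • y = 0
    rw [← Finset.mul_prod_erase _ _ hr, mul_comm, mul_smul, hty r (hTp r hr), smul_zero]
  · rw [map_smul, ← hy, mul_smul]

variable {E : Type u} [AddCommGroup E] [Module R E] {f : N →ₗ[R] E}

/-- The socle of the localization of an injective hull of `N` dies in the cokernel of `N`. -/
theorem IsInjectiveHull.map_socleAt_eq_zero [IsNoetherianRing R] (hf : IsInjectiveHull f)
    {x : atPrime p E} (hx : x ∈ socleAt p E) :
    LocalizedModule.map p.asIdeal.primeCompl (LinearMap.range f).mkQ x = 0 := by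
  obtain ⟨s, hs, y, hy, hyx⟩ := exists_smul_eq_toAtPrime hx
  by_cases hy0 : y = 0
  · rw [hy0, map_zero, eq_comm, smul_atPrime_eq_zero_iff hs] at hyx
    rw [hyx, map_zero]
  obtain ⟨r, n, hn, hr⟩ := hf.exists_smul_eq hy0
  -- `r` and `s` lie outside `p`, hence act injectively on the localized cokernel, and `r • s • x`
  -- is the image of `n ∈ N`.
  have hrp : r ∉ p.asIdeal := fun h => hr (hy r h)
  rw [← smul_atPrime_eq_zero_iff (p := p) hs, ← smul_atPrime_eq_zero_iff (p := p) hrp]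
  have key : ∀ (c : R) (z : atPrime p E),
      LocalizedModule.map p.asIdeal.primeCompl (LinearMap.range f).mkQ (c • z) =
        c • LocalizedModule.map p.asIdeal.primeCompl (LinearMap.range f).mkQ z := fun c z => by
    rw [← algebraMap_smul (Localization.AtPrime p.asIdeal) c z, map_smul, algebraMap_smul]
  rw [← key, ← key, ← hyx, ← map_smul, ← hn]
  change LocalizedModule.map _ _ (LocalizedModule.mk (f n) 1) = 0
  rw [LocalizedModule.map_mk, Submodule.mkQ_apply,
    (Submodule.Quotient.mk_eq_zero (LinearMap.range f)).2 (LinearMap.mem_range_self f n),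
    LocalizedModule.zero_mk]

theorem bassNumber_zero (N : Type u) [AddCommGroup N] [Module R N] :
    bassNumber 0 p N =
      Module.rank (ResidueField (Localization.AtPrime p.asIdeal)) (socleAt p N) :=
  rank_residueField_eq (residueExtZeroEquiv _)

/-- Localizing `0 → N → E → E/N → 0` keeps the middle term injective (`R` is Noetherian).
Essentiality makes the shift valid also for `i = 0`, where `Ext^0(k, E_p)` need not vanish. -/
theorem IsInjectiveHull.bassNumber_succ [IsNoetherianRing R] (hf : IsInjectiveHull f) (i : ℕ) :
    bassNumber (i + 1) p N = bassNumber i p (E ⧸ LinearMap.range f) := by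
  have : Module.Injective R E := hf.module_injective
  have hE : Module.Injective (Localization.AtPrime p.asIdeal) (atPrime p E) :=
    Module.injective_of_isLocalizedModule p.asIdeal.primeCompl (toAtPrime p E)
  obtain ⟨l⟩ := nonempty_residueExt_succ_equiv
    (LocalizedModule.map p.asIdeal.primeCompl f)
    (LocalizedModule.map p.asIdeal.primeCompl (LinearMap.range f).mkQ)
    (LocalizedModule.map_injective _ _ hf.injective)
    (LocalizedModule.map_exact _ _ _ (LinearMap.exact_map_mkQ_range f))
    (LocalizedModule.map_surjective _ _ (Submodule.mkQ_surjective _)) hE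
    (fun x hx => hf.map_socleAt_eq_zero hx) i
  exact (rank_residueField_eq l).symm

end Localize

end RelativeCM

namespace RelativeCM

/-! ### Lifting bases of socles to `N`. -/

section SocleFamily

open IsLocalRing

variable {R : Type u} [CommRing R] {p : PrimeSpectrum R} {N : Type u} [AddCommGroup N] [Module R N]

theorem coe_residue_smul (c : R) (v : socleAt p N) :
    ((residue (Localization.AtPrime p.asIdeal) (algebraMap R _ c) • v : socleAt p N) :
      atPrime p N) = c • (v : atPrime p N) := by
  rw [← ResidueField.algebraMap_eq, algebraMap_smul, Submodule.coe_smul, algebraMap_smul]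

theorem residue_algebraMap_eq_zero_iff {c : R} :
    residue (Localization.AtPrime p.asIdeal) (algebraMap R _ c) = 0 ↔ c ∈ p.asIdeal := by
  rw [residue_eq_zero_iff, IsLocalization.AtPrime.to_map_mem_maximal_iff _ p.asIdeal]

variable (p N) in
/-- The socle of `N_p` has a basis consisting of images of elements of `N` annihilated by `p`. -/
theorem exists_basis_socleAt [IsNoetherianRing R] :
    ∃ (e : (bassNumber 0 p N).out → N)
      (b : Module.Basis (bassNumber 0 p N).out (ResidueField (Localization.AtPrime p.asIdeal))
        (socleAt p N)),
      (∀ i, ∀ r ∈ p.asIdeal, r • e i = 0) ∧ ∀ i, (b i : atPrime p N) = toAtPrime p N (e i) := by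
  let b₀ := Module.Basis.ofVectorSpace (ResidueField (Localization.AtPrime p.asIdeal)) (socleAt p N)
  have hcard : Cardinal.mk (Module.Basis.ofVectorSpaceIndex
      (ResidueField (Localization.AtPrime p.asIdeal)) (socleAt p N)) =
      Cardinal.mk (bassNumber 0 p N).out := by
    rw [Cardinal.mk_out, bassNumber_zero]
    exact b₀.mk_eq_rank''
  let b := b₀.reindex (Cardinal.eq.1 hcard).some
  choose s hs e he hes using fun i => exists_smul_eq_toAtPrime (b i).2
  -- Rescaling by `s i ∉ p`, a unit in the residue field, keeps a basis and clears denominators.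
  refine ⟨e, b.isUnitSMul
    (w := fun i => residue (Localization.AtPrime p.asIdeal) (algebraMap R _ (s i)))
    fun i => IsUnit.mk0 _ (residue_algebraMap_eq_zero_iff.not.2 (hs i)), he, fun i => ?_⟩
  rw [Module.Basis.isUnitSMul_apply, coe_residue_smul, hes]

variable {ι : Type u} {e : ι → N}
  (b : Module.Basis ι (ResidueField (Localization.AtPrime p.asIdeal)) (socleAt p N))
  (hb : ∀ i, (b i : atPrime p N) = toAtPrime p N (e i))
include b hb

theorem mem_of_linearCombination_eq_zero (c : ι →₀ R)
    (hc : Finsupp.linearCombination R e c = 0) (i : ι) : c i ∈ p.asIdeal := by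
  let ρ : R →+* ResidueField (Localization.AtPrime p.asIdeal) := (residue _).comp (algebraMap R _)
  have key : ∀ c : ι →₀ R, ((Finsupp.linearCombination _ b (c.mapRange ρ ρ.map_zero) :
      socleAt p N) : atPrime p N) = toAtPrime p N (Finsupp.linearCombination R e c) := by
    intro c
    induction c using Finsupp.induction_linear with
    | zero => simp
    | add c d hc hd =>
      rw [Finsupp.mapRange_add ρ.map_add, map_add, Submodule.coe_add, hc, hd, map_add, map_add]
    | single i r =>
      rw [Finsupp.mapRange_single, Finsupp.linearCombination_single,
        Finsupp.linearCombination_single, map_smul, ← hb]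
      exact coe_residue_smul r (b i)
  have h := key c
  rw [hc, map_zero, ZeroMemClass.coe_eq_zero] at h
  have h' := DFunLike.congr_fun (linearIndependent_iff.1 b.linearIndependent _ h) i
  exact residue_algebraMap_eq_zero_iff.1 h'

/-- Every socle vector times some `m ∉ p` is the image of an element of the span; a further
multiplier absorbs the kernel of localization. -/
theorem exists_smul_mem_span {x : N} (hx : ∀ r ∈ p.asIdeal, r • x = 0) :
    ∃ t ∉ p.asIdeal, t • x ∈ Submodule.span R (Set.range e) := by
  have key : ∀ v : socleAt p N, ∃ m ∉ p.asIdeal, ∃ y ∈ Submodule.span R (Set.range e),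
      toAtPrime p N y = m • (v : atPrime p N) := by
    intro v
    induction b.mem_span v using Submodule.span_induction with
    | mem v hv =>
      obtain ⟨i, rfl⟩ := hv
      exact ⟨1, (Ideal.ne_top_iff_one _).1 p.isPrime.ne_top, e i,
        Submodule.subset_span ⟨i, rfl⟩, by rw [one_smul, hb]⟩
    | zero =>
      exact ⟨1, (Ideal.ne_top_iff_one _).1 p.isPrime.ne_top, 0, zero_mem _, by simp⟩
    | add v w _ _ hv hw =>
      obtain ⟨m, hm, y, hy, hyv⟩ := hv
      obtain ⟨n, hn, z, hz, hzw⟩ := hw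
      refine ⟨m * n, fun h => (p.isPrime.mem_or_mem h).elim hm hn, n • y + m • z,
        add_mem (Submodule.smul_mem _ _ hy) (Submodule.smul_mem _ _ hz), ?_⟩
      rw [map_add, map_smul, map_smul, hyv, hzw, Submodule.coe_add, smul_add, mul_smul, mul_smul,
        smul_comm n m (v : atPrime p N)]
    | smul κ v _ hv =>
      obtain ⟨m, hm, y, hy, hyv⟩ := hv
      obtain ⟨r, rfl⟩ := residue_surjective κ
      obtain ⟨a, s, rfl⟩ := IsLocalization.exists_mk'_eq p.asIdeal.primeCompl r
      refine ⟨m * s, fun h => (p.isPrime.mem_or_mem h).elim hm s.2, a • y,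
        Submodule.smul_mem _ _ hy, ?_⟩
      rw [map_smul, hyv, mul_smul, ← coe_residue_smul s.1, ← mul_smul (residue _ _),
        ← map_mul, mul_comm (algebraMap R _ _), IsLocalization.mk'_spec, coe_residue_smul,
        smul_comm]
  obtain ⟨m, hm, y, hy, hym⟩ := key ⟨toAtPrime p N x, mem_socleAt.2 fun r hr => by
    rw [← map_smul, hx r hr, map_zero]⟩
  have h0 : toAtPrime p N (m • x - y) = 0 := by rw [map_sub, hym, map_smul, sub_self]
  obtain ⟨s, hs, h⟩ := toAtPrime_eq_zero_iff.1 h0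
  rw [smul_sub, sub_eq_zero, ← mul_smul] at h
  exact ⟨s * m, fun h' => (p.isPrime.mem_or_mem h').elim hs hm, h ▸ Submodule.smul_mem _ _ hy⟩

end SocleFamily

/-! ### Torsion of hulls and associated primes in terms of Bass numbers. -/

section

variable {R : Type u} [CommRing R] [IsNoetherianRing R] (a : Ideal R) (N : Type u) [AddCommGroup N]
  [Module R N]

theorem exists_isSocleFamily :
    ∃ e : (Σ p : PrimeSpectrum.zeroLocus (a : Set R), (bassNumber 0 p.1 N).out) → N,
      IsSocleFamily a (fun i => i.1.1) e := by
  classical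
  choose e b he hb using fun p => exists_basis_socleAt (R := R) p N
  refine ⟨fun i => e i.1.1 i.2, fun i => i.1.2, fun i => he i.1.1 i.2, ?_, ?_⟩
  · intro q c hc h i
    by_cases hi : i ∈ c.support
    swap
    · rw [Finsupp.notMem_support_iff.1 hi]
      exact zero_mem _
    obtain ⟨p, i⟩ := i
    obtain rfl : p.1 = q := hc _ hi
    let k : (bassNumber 0 p.1 N).out →
        Σ p : PrimeSpectrum.zeroLocus (a : Set R), (bassNumber 0 p.1 N).out := fun i => ⟨p, i⟩
    have hk : Function.Injective k := @sigma_mk_injective _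
      (fun p : PrimeSpectrum.zeroLocus (a : Set R) => (bassNumber 0 p.1 N).out) p
    -- A relation supported on indices with prime `q` lives in one fibre of the sigma type, where
    -- the basis property applies.
    refine mem_of_linearCombination_eq_zero (b p.1) (hb p.1)
      (c.comapDomain k hk.injOn) ?_ i
    rw [← h, Finsupp.linearCombination_apply, Finsupp.linearCombination_apply]
    refine Finsupp.sum_comapDomain k c (fun i r => r • e i.1.1 i.2)
      ⟨fun _ h => h, hk.injOn, ?_⟩
    rintro ⟨p', i'⟩ hi'
    obtain rfl : p' = p := Subtype.ext (hc _ hi')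
    exact ⟨i', hi', rfl⟩
  · intro q x hq hx
    obtain ⟨t, ht, h⟩ := exists_smul_mem_span (b q) (hb q) hx
    refine ⟨t, ht, Submodule.span_mono ?_ h⟩
    rintro _ ⟨i, rfl⟩
    exact ⟨⟨⟨q, hq⟩, i⟩, rfl⟩

variable {a N} {E : Type u} [AddCommGroup E] [Module R E] {f : N →ₗ[R] E}

theorem IsInjectiveHull.injective_gamma (hf : IsInjectiveHull f) (a : Ideal R) :
    Module.Injective R (gamma a E) := by
  obtain ⟨e, he⟩ := exists_isSocleFamily a N
  exact he.injective_gamma hf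

theorem IsInjectiveHull.nonempty_gamma_equiv (hf : IsInjectiveHull f) (a : Ideal R) :
    Nonempty (gamma a E ≃ₗ[R] bassSum a 0 N) := by
  classical
  obtain ⟨e, he⟩ := exists_isSocleFamily a N
  obtain ⟨l⟩ := he.nonempty_linearEquiv hf
  exact ⟨l ≪≫ₗ DirectSum.sigmaLcurryEquiv R
    (δ := fun (p : PrimeSpectrum.zeroLocus (a : Set R)) (_ : (bassNumber 0 p.1 N).out) =>
      injectiveHull R (R ⧸ p.1.asIdeal)) ≪≫ₗ
    DFinsupp.mapRange.linearEquiv fun p => (finsuppLEquivDirectSum R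
      (injectiveHull R (R ⧸ p.1.asIdeal)) (bassNumber 0 p.1 N).out).symm⟩

/-- A nonzero socle vector lifts to an element killed by `p` and nonzero in `N_p`, so with
annihilator exactly `p`; conversely such an element survives localization. -/
theorem bassNumber_zero_ne_zero_iff {p : PrimeSpectrum R} :
    bassNumber 0 p N ≠ 0 ↔ p.asIdeal ∈ associatedPrimes R N := by
  rw [bassNumber_zero, Ne, rank_zero_iff, not_subsingleton_iff_nontrivial,
    Submodule.nontrivial_iff_ne_bot, Submodule.ne_bot_iff, AssociatedPrimes.mem_iff,
    isAssociatedPrime_iff]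
  constructor
  · rintro ⟨v, hv, hv0⟩
    obtain ⟨s, hs, y, hy, hyv⟩ := exists_smul_eq_toAtPrime hv
    refine ⟨p.isPrime, y, ?_⟩
    ext r
    rw [Submodule.mem_colon_singleton, Submodule.mem_bot]
    refine ⟨hy r, fun h => ?_⟩
    by_contra hr
    rw [toAtPrime_eq_zero_iff.2 ⟨r, hr, h⟩, eq_comm, smul_atPrime_eq_zero_iff hs] at hyv
    exact hv0 hyv
  · rintro ⟨-, y, hy⟩
    have h : ∀ r, r ∈ p.asIdeal ↔ r • y = 0 := fun r => by
      rw [hy, Submodule.mem_colon_singleton, Submodule.mem_bot]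
    refine ⟨toAtPrime p N y, mem_socleAt.2 fun r hr => ?_, fun h0 => ?_⟩
    · rw [← map_smul, (h r).1 hr, map_zero]
    · obtain ⟨s, hs, hsy⟩ := toAtPrime_eq_zero_iff.1 h0
      exact hs ((h s).2 hsy)

theorem associatedPrimes_gamma : associatedPrimes R (gamma a N) =
    PrimeSpectrum.asIdeal ''
      {p | p ∈ PrimeSpectrum.zeroLocus (a : Set R) ∧ bassNumber 0 p N ≠ 0} := by
  ext I
  simp only [bassNumber_zero_ne_zero_iff, Set.mem_image, Set.mem_ofPred_eq]
  constructor
  · intro hI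
    refine ⟨⟨I, hI.isPrime⟩, ⟨?_, hI.map_of_injective (gamma a N).subtype
      (gamma a N).injective_subtype⟩, rfl⟩
    obtain ⟨hp, ⟨x, t, ht⟩, hx⟩ := isAssociatedPrime_iff.1 hI
    refine hp.le_of_pow_le (n := t) fun r hr => ?_
    rw [hx, Submodule.mem_colon_singleton, Submodule.mem_bot]
    exact Subtype.ext (ht r hr)
  · rintro ⟨p, ⟨hap, hp⟩, rfl⟩
    obtain ⟨-, x, hx⟩ := isAssociatedPrime_iff.1 hp
    have h : ∀ r, r ∈ p.asIdeal ↔ r • x = 0 := fun r => by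
      rw [hx, Submodule.mem_colon_singleton, Submodule.mem_bot]
    refine isAssociatedPrime_iff.2 ⟨p.isPrime, ⟨x, 1, fun r hr => (h r).1 ?_⟩, ?_⟩
    · rw [pow_one] at hr
      exact hap hr
    · ext r
      rw [h, Submodule.mem_colon_singleton, Submodule.mem_bot, Subtype.ext_iff]
      rfl

end

end RelativeCM

namespace RelativeCM

/-! ### Injective resolutions from exact sequences of modules. -/

section Complex

variable {R : Type u} [CommRing R]

/-- The cochain complex of modules with given terms and differentials. -/
abbrev complexOf (X : ℕ → ModuleCat.{u} R) (d : ∀ j, X j →ₗ[R] X (j + 1))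
    (hd : ∀ j, d (j + 1) ∘ₗ d j = 0) : CochainComplex (ModuleCat.{u} R) ℕ :=
  CochainComplex.of X (fun j => ModuleCat.ofHom (d j)) fun j => ModuleCat.hom_ext (hd j)

variable {X : ℕ → ModuleCat.{u} R} {d : ∀ j, X j →ₗ[R] X (j + 1)}

theorem complexOf_d (hd : ∀ j, d (j + 1) ∘ₗ d j = 0) (j : ℕ) :
    (complexOf X d hd).d j (j + 1) = ModuleCat.ofHom (d j) :=
  CochainComplex.of_d X (fun j => ModuleCat.ofHom (d j)) j

theorem complexOf_exactAt_succ_iff (hd : ∀ j, d (j + 1) ∘ₗ d j = 0) (j : ℕ) :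
    (complexOf X d hd).ExactAt (j + 1) ↔ Function.Exact (d j) (d (j + 1)) := by
  rw [HomologicalComplex.exactAt_iff' _ j (j + 1) (j + 1 + 1) (by simp) (by simp),
    ShortComplex.ShortExact.moduleCat_exact_iff_function_exact]
  change Function.Exact ((complexOf X d hd).d j (j + 1)) ((complexOf X d hd).d (j + 1) (j + 1 + 1))
    ↔ _
  rw [complexOf_d, complexOf_d]
  rfl

/-- The augmentation of the complex `X` by a map `f : Z → X 0`. -/
noncomputable def augmentation (hd : ∀ j, d (j + 1) ∘ₗ d j = 0) (Z : ModuleCat.{u} R)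
    (f : Z →ₗ[R] X 0) (hf : d 0 ∘ₗ f = 0) :
    (CochainComplex.single₀ (ModuleCat.{u} R)).obj Z ⟶ complexOf X d hd :=
  (CochainComplex.fromSingle₀Equiv _ _).symm ⟨ModuleCat.ofHom f, by
    rw [complexOf_d]
    exact ModuleCat.hom_ext hf⟩

theorem augmentation_f_zero (hd : ∀ j, d (j + 1) ∘ₗ d j = 0) (Z : ModuleCat.{u} R)
    (f : Z →ₗ[R] X 0) (hf : d 0 ∘ₗ f = 0) :
    (augmentation hd Z f hf).f 0 = ModuleCat.ofHom f :=
  CochainComplex.fromSingle₀Equiv_symm_apply_f_zero _ _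

/-- An exact sequence `0 → Z → X 0 → X 1 → ⋯` with injective modules `X j` is an injective
resolution of `Z`. -/
noncomputable def injectiveResolutionOfExact (hd : ∀ j, Function.Exact (d j) (d (j + 1)))
    (hX : ∀ j, Module.Injective R (X j)) (Z : ModuleCat.{u} R) (f : Z →ₗ[R] X 0)
    (hf : Function.Injective f) (hfd : Function.Exact f (d 0)) : InjectiveResolution Z where
  cocomplex := complexOf X d fun j => (hd j).linearMap_comp_eq_zero
  injective j := (Module.injective_iff_injective_object R (X j)).1 (hX j)
  ι := augmentation _ Z f hfd.linearMap_comp_eq_zero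
  quasiIso := ⟨fun n => by
    -- In degree `0` the condition is exactness of `0 → Z → X 0 → X 1`; in higher degrees the source
    -- is exact, so it is exactness of `X`.
    cases n
    · rw [CochainComplex.quasiIsoAt₀_iff, ShortComplex.quasiIso_iff_of_zeros]
      · refine (ShortComplex.exact_and_mono_f_iff_of_iso
          (S₂ := ShortComplex.mk (ModuleCat.ofHom f) (ModuleCat.ofHom (d 0))
            (ModuleCat.hom_ext hfd.linearMap_comp_eq_zero)) ?_).2
          ⟨(ShortComplex.ShortExact.moduleCat_exact_iff_function_exact _).2 hfd,
            (ModuleCat.mono_iff_injective _).2 hf⟩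
        refine ShortComplex.isoMk (Iso.refl _) (Iso.refl _) (Iso.refl _) ?_ ?_
        · change 𝟙 Z ≫ ModuleCat.ofHom f = (augmentation _ Z f hfd.linearMap_comp_eq_zero).f 0 ≫ 𝟙 (X 0)
          rw [augmentation_f_zero]
          rfl
        · change 𝟙 (X 0) ≫ ModuleCat.ofHom (d 0) = (complexOf X d fun j => (hd j).linearMap_comp_eq_zero).d 0 1 ≫ 𝟙 (X 1)
          rw [complexOf_d]
          rfl
      all_goals rfl
    · rw [quasiIsoAt_iff_exactAt]
      · exact (complexOf_exactAt_succ_iff _ _).2 (hd _)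
      · apply CochainComplex.exactAt_succ_single_obj⟩

theorem isMinimal_injectiveResolutionOfExact (hd : ∀ j, Function.Exact (d j) (d (j + 1)))
    (hX : ∀ j, Module.Injective R (X j)) (Z : ModuleCat.{u} R) (f : Z →ₗ[R] X 0)
    (hf : Function.Injective f) (hfd : Function.Exact f (d 0))
    (h : ∀ j, IsEssential (LinearMap.ker (d j))) :
    IsMinimalInjectiveResolution (injectiveResolutionOfExact hd hX Z f hf hfd) := by
  intro j
  change IsEssential (LinearMap.ker
    ((complexOf X d fun j => (hd j).linearMap_comp_eq_zero).d j (j + 1)).hom)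
  rw [complexOf_d]
  exact h j

end Complex

/-! ### The minimal injective resolution and its torsion complex. -/

section MinimalResolution

variable (R : Type u) [CommRing R] (M : Type u) [AddCommGroup M] [Module R M]

/-- The cosyzygies of `M` in its minimal injective resolution. -/
noncomputable def cosyzygy : ℕ → ModuleCat.{u} R
  | 0 => ModuleCat.of R M
  | j + 1 => ModuleCat.of R
      (injectiveHull R (cosyzygy j) ⧸ LinearMap.range (toInjectiveHull R (cosyzygy j)))

/-- The terms of the minimal injective resolution of `M`. -/
noncomputable abbrev hullTerm (j : ℕ) : ModuleCat.{u} R :=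
  injectiveHull R (cosyzygy R M j)

/-- The projection from a term of the minimal injective resolution to the next cosyzygy. -/
noncomputable def toCosyzygy (j : ℕ) : hullTerm R M j →ₗ[R] cosyzygy R M (j + 1) :=
  (LinearMap.range (toInjectiveHull R (cosyzygy R M j))).mkQ

/-- The differentials of the minimal injective resolution of `M`. -/
noncomputable def hullDiff (j : ℕ) : hullTerm R M j →ₗ[R] hullTerm R M (j + 1) :=
  toInjectiveHull R (cosyzygy R M (j + 1)) ∘ₗ toCosyzygy R M j

variable {R M}

theorem toInjectiveHull_injective (N : Type u) [AddCommGroup N] [Module R N] :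
    Function.Injective (toInjectiveHull R N) :=
  (isInjectiveHull_toInjectiveHull R N).injective

theorem hullDiff_eq_zero_iff (j : ℕ) (x : hullTerm R M j) :
    hullDiff R M j x = 0 ↔ x ∈ LinearMap.range (toInjectiveHull R (cosyzygy R M j)) := by
  change toInjectiveHull R _ (toCosyzygy R M j x) = 0 ↔ _
  rw [map_eq_zero_iff _ (toInjectiveHull_injective _)]
  exact Submodule.Quotient.mk_eq_zero _

theorem hullDiff_exact (j : ℕ) : Function.Exact (hullDiff R M j) (hullDiff R M (j + 1)) := by
  intro x
  rw [hullDiff_eq_zero_iff]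
  constructor
  · rintro ⟨y, rfl⟩
    obtain ⟨z, rfl⟩ := Submodule.mkQ_surjective _ y
    exact ⟨z, rfl⟩
  · rintro ⟨z, rfl⟩
    exact ⟨_, rfl⟩

theorem hullDiff_comp (j : ℕ) : hullDiff R M (j + 1) ∘ₗ hullDiff R M j = 0 :=
  (hullDiff_exact j).linearMap_comp_eq_zero

/-- Each cosyzygy shifts the degree by one; `i = 0` reads `μ^j(p, M)` off a socle. -/
theorem bassNumber_cosyzygy [IsNoetherianRing R] (p : PrimeSpectrum R) (i j : ℕ) :
    bassNumber i p (cosyzygy R M j) = bassNumber (j + i) p M := by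
  induction j generalizing i with
  | zero => rw [Nat.zero_add]; rfl
  | succ j ih =>
    rw [Nat.succ_add_eq_add_succ, ← ih (i + 1)]
    exact ((isInjectiveHull_toInjectiveHull R (cosyzygy R M j)).bassNumber_succ i).symm

/-- The minimal injective resolution of `M`. -/
noncomputable def hullResolution (R M : Type u) [CommRing R] [AddCommGroup M] [Module R M] :
    InjectiveResolution (ModuleCat.of R M) :=
  injectiveResolutionOfExact hullDiff_exact
    (fun j => (isInjectiveHull_toInjectiveHull R (cosyzygy R M j)).module_injective)
    (ModuleCat.of R M) (toInjectiveHull R M) (toInjectiveHull_injective M)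
    (fun x => hullDiff_eq_zero_iff (M := M) 0 x)

variable (a : Ideal R)

/-- The differentials obtained by applying `Γ_a` to the minimal injective resolution of `M`. -/
noncomputable abbrev gammaDiff (R M : Type u) [CommRing R] [AddCommGroup M] [Module R M]
    (a : Ideal R) (j : ℕ) :
    gamma a (hullTerm R M j) →ₗ[R] gamma a (hullTerm R M (j + 1)) :=
  gammaMap a (hullDiff R M j)

theorem gammaDiff_comp (j : ℕ) : gammaDiff R M a (j + 1) ∘ₗ gammaDiff R M a j = 0 := by
  ext x
  exact LinearMap.congr_fun (hullDiff_comp j) x.1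

/-- The complex of `a`-torsion submodules of the minimal injective resolution of `M`. -/
noncomputable abbrev gammaComplex (R M : Type u) [CommRing R] [AddCommGroup M] [Module R M]
    (a : Ideal R) : CochainComplex (ModuleCat.{u} R) ℕ :=
  complexOf (fun j => ModuleCat.of R (gamma a (hullTerm R M j))) (gammaDiff R M a)
    (gammaDiff_comp a)

variable (M) in
/-- Applying `Γ_a` to the minimal injective resolution of `M` gives `gammaComplex`. -/
noncomputable def gammaComplexIso :
    ((gammaFunctor a).mapHomologicalComplex _).obj (hullResolution R M).cocomplex ≅
      gammaComplex R M a :=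
  HomologicalComplex.Hom.isoOfComponents (fun j => Iso.refl _) (by
    rintro i j (rfl : i + 1 = j)
    change 𝟙 _ ≫ (gammaComplex R M a).d i (i + 1) =
      (gammaFunctor a).map ((complexOf (hullTerm R M) (hullDiff R M) hullDiff_comp).d i (i + 1)) ≫
        𝟙 _
    rw [complexOf_d, complexOf_d, Category.id_comp, Category.comp_id]
    rfl)

variable (M) in
/-- Local cohomology is the cohomology of `Γ_a` of the minimal injective resolution. -/
noncomputable def localCohomologyIso (i : ℕ) :
    localCohomologyModule a i M ≅ (gammaComplex R M a).homology i :=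
  (hullResolution R M).isoRightDerivedObj (gammaFunctor a) i ≪≫
    (HomologicalComplex.homologyFunctor _ _ i).mapIso (gammaComplexIso M a)

theorem localCohomology_subsingleton_iff (i : ℕ) :
    Subsingleton (localCohomologyModule a i M) ↔ (gammaComplex R M a).ExactAt i := by
  rw [HomologicalComplex.exactAt_iff_isZero_homology, ← ModuleCat.isZero_iff_subsingleton]
  exact (localCohomologyIso M a i).isZero_iff

/-- The index `k` is free because homology uses `(ComplexShape.up ℕ).next n`, which is not `n + 1`
by definition. -/
theorem nonempty_gammaComplex_ker_equiv (n k : ℕ) (h : n + 1 = k) :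
    Nonempty (LinearMap.ker ((gammaComplex R M a).d n k).hom ≃ₗ[R]
      LinearMap.ker (gammaDiff R M a n)) := by
  subst h
  rw [complexOf_d]
  exact ⟨LinearEquiv.refl _ _⟩

/-- The torsion of a cosyzygy as a module of cycles. -/
theorem nonempty_gamma_cosyzygy_equiv (n : ℕ) :
    Nonempty (gamma a (cosyzygy R M n) ≃ₗ[R] LinearMap.ker (gammaDiff R M a n)) := by
  let f := toInjectiveHull R (cosyzygy R M n)
  have hf : Function.Injective f := toInjectiveHull_injective _
  refine ⟨LinearEquiv.ofBijective ((gammaMap a f).codRestrict _ fun x => ?_) ⟨?_, ?_⟩⟩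
  · exact Subtype.ext ((hullDiff_eq_zero_iff n _).2 ⟨x.1, rfl⟩)
  · intro x y h
    exact Subtype.ext (hf (congrArg (fun z => z.1.1) h))
  · rintro ⟨⟨x, t, ht⟩, hx⟩
    obtain ⟨y, rfl⟩ := (hullDiff_eq_zero_iff n x).1 (congrArg Subtype.val hx)
    refine ⟨⟨y, t, fun r hr => hf ?_⟩, rfl⟩
    rw [map_smul, map_zero]
    exact ht r hr

/-- If `Γ_a` kills the terms of the minimal injective resolution of `M` in degrees below `n`, then
`H^n_a(M)` is the torsion of the `n`-th cosyzygy. -/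
theorem nonempty_localCohomology_equiv (n : ℕ)
    (hn : ∀ j < n, Subsingleton (gamma a (hullTerm R M j))) :
    Nonempty (localCohomologyModule a n M ≃ₗ[R] gamma a (cosyzygy R M n)) := by
  let T := (gammaComplex R M a).sc n
  -- No coboundaries enter degree `n`, so homology there is the module of cycles.
  have hz : T.f = 0 := by
    cases n with
    | zero => exact (gammaComplex R M a).shape _ _ (by simp)
    | succ n =>
      have hp : (ComplexShape.up ℕ).prev (n + 1) = n := by simp
      have : Subsingleton T.X₁ := by
        change Subsingleton (gamma a (hullTerm R M ((ComplexShape.up ℕ).prev (n + 1))))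
        rw [hp]
        exact hn n n.lt_succ_self
      ext x
      rw [Subsingleton.elim x 0, map_zero, map_zero]
  have hr : LinearMap.range T.moduleCatToCycles = ⊥ := by
    rw [LinearMap.range_eq_bot]
    ext x
    change T.f x = 0
    rw [hz]
    rfl
  obtain ⟨k⟩ := nonempty_gammaComplex_ker_equiv (M := M) a n ((ComplexShape.up ℕ).next n) (by simp)
  obtain ⟨l⟩ := nonempty_gamma_cosyzygy_equiv (M := M) a n
  exact ⟨((localCohomologyIso M a n).toLinearEquiv ≪≫ₗ T.moduleCatHomologyIso.toLinearEquiv) ≪≫ₗ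
    Submodule.quotEquivOfEqBot _ hr ≪≫ₗ k ≪≫ₗ l.symm⟩

/-- A term of the minimal injective resolution has no torsion if its cosyzygy has none. -/
theorem gamma_hullTerm_subsingleton (j : ℕ) (h : ∀ x, gammaDiff R M a j x = 0 → x = 0) :
    Subsingleton (gamma a (hullTerm R M j)) := by
  refine subsingleton_of_forall_eq 0 fun x => ?_
  by_contra hx
  have hx' : x.1 ≠ 0 := fun h => hx (Subtype.ext h)
  obtain ⟨r, y, hy, hr⟩ :=
    (isInjectiveHull_toInjectiveHull R (cosyzygy R M j)).exists_smul_eq hx'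
  have := h (r • x) (Subtype.ext ((hullDiff_eq_zero_iff j _).2 ⟨y, hy⟩))
  exact hr (congrArg Subtype.val this)

/-- Vanishing of `H^j` and of the previous term makes the differential injective in degree `j`; its
kernel being essential, the term is zero. -/
theorem gamma_hullTerm_subsingleton_of_lt (n : ℕ)
    (h : ∀ i < n, Subsingleton (localCohomologyModule a i M)) :
    ∀ j < n, Subsingleton (gamma a (hullTerm R M j)) := by
  intro j
  induction j with
  | zero =>
    intro hj
    refine gamma_hullTerm_subsingleton a 0 fun x hx => ?_
    obtain ⟨l⟩ := nonempty_localCohomology_equiv (M := M) a 0 (by simp)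
    obtain ⟨l'⟩ := nonempty_gamma_cosyzygy_equiv (M := M) a 0
    have := h 0 hj
    have : Subsingleton (LinearMap.ker (gammaDiff R M a 0)) :=
      (l ≪≫ₗ l').symm.toEquiv.subsingleton
    exact congrArg Subtype.val (Subsingleton.elim (⟨x, hx⟩ : LinearMap.ker (gammaDiff R M a 0)) 0)
  | succ j ih =>
    intro hj
    have := ih (Nat.lt_of_succ_lt hj)
    refine gamma_hullTerm_subsingleton a (j + 1) fun x hx => ?_
    obtain ⟨y, rfl⟩ := ((complexOf_exactAt_succ_iff (gammaDiff_comp a) j).1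
      ((localCohomology_subsingleton_iff a (j + 1)).1 (h _ hj)) x).1 hx
    rw [Subsingleton.elim y 0, map_zero]

/-- Multiples of torsion elements are torsion, so essentiality of the cosyzygy in its hull passes to
`Γ_a`. This yields minimality. -/
theorem gammaDiff_ker_isEssential (j : ℕ) :
    IsEssential (LinearMap.ker (gammaDiff R M a j)) := by
  refine isEssential_of_exists_smul_mem fun x hx => ?_
  have hx' : x.1 ≠ 0 := fun h => hx (Subtype.ext h)
  obtain ⟨r, y, hy, hr⟩ :=
    (isInjectiveHull_toInjectiveHull R (cosyzygy R M j)).exists_smul_eq hx'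
  exact ⟨r, Subtype.ext ((hullDiff_eq_zero_iff j _).2 ⟨y, hy⟩),
    fun h => hr (congrArg Subtype.val h)⟩

theorem nonempty_gamma_hullTerm_equiv [IsNoetherianRing R] (j : ℕ) :
    Nonempty (gamma a (hullTerm R M j) ≃ₗ[R] bassSum a j M) := by
  have h : ∀ c c' : PrimeSpectrum.zeroLocus (a : Set R) → Cardinal.{u}, c = c' → Nonempty
      (DirectSum _ (fun p => (c p).out →₀ injectiveHull R (R ⧸ p.1.asIdeal)) ≃ₗ[R]
        DirectSum _ fun p => (c' p).out →₀ injectiveHull R (R ⧸ p.1.asIdeal)) := by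
    rintro c _ rfl
    exact ⟨LinearEquiv.refl _ _⟩
  obtain ⟨l⟩ := (isInjectiveHull_toInjectiveHull R (cosyzygy R M j)).nonempty_gamma_equiv a
  obtain ⟨l'⟩ := h _ _ (funext fun p => bassNumber_cosyzygy (M := M) p.1 0 j)
  exact ⟨l ≪≫ₗ l'⟩

end MinimalResolution

end RelativeCM

/-! ### The resolution of `H^n_a(M)` and its associated primes. -/

theorem proposition2p8 {R : Type u} [CommRing R] [IsNoetherianRing R] (a : Ideal R) (ha : a ≠ ⊤)
    (M : Type u) [AddCommGroup M] [Module R M]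
    (hM : RelativeCM.IsRelativeCohenMacaulay a M)
    (n : ℕ) (hn : RelativeCM.IsCohomologicalDimension a M n) :
    (∃ I : CategoryTheory.InjectiveResolution (RelativeCM.localCohomologyModule a n M),
      RelativeCM.IsMinimalInjectiveResolution I ∧
      ∀ j : ℕ, Nonempty (I.cocomplex.X j ≃ₗ[R] RelativeCM.bassSum a (n + j) M)) ∧
    associatedPrimes R (RelativeCM.localCohomologyModule a n M) =
      PrimeSpectrum.asIdeal ''
        {p | p ∈ PrimeSpectrum.zeroLocus (a : Set R) ∧ RelativeCM.bassNumber n p M ≠ 0} := by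
  open RelativeCM in
  have hvan : ∀ i, i ≠ n → Subsingleton (localCohomologyModule a i M) := fun i hi =>
    not_nontrivial_iff_subsingleton.1 fun h => hi (hM.existsUnique.unique h hn.1)
  obtain ⟨l⟩ := nonempty_localCohomology_equiv a n
    (gamma_hullTerm_subsingleton_of_lt a n fun i hi => hvan i hi.ne)
  obtain ⟨l'⟩ := nonempty_gamma_cosyzygy_equiv (M := M) a n
  refine ⟨?_, ?_⟩
  · let f : localCohomologyModule a n M →ₗ[R] gamma a (hullTerm R M n) :=
      (LinearMap.ker (gammaDiff R M a n)).subtype ∘ₗ (l ≪≫ₗ l').toLinearMap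
    have hf : Function.Injective f := (Submodule.injective_subtype _).comp (l ≪≫ₗ l').injective
    have hfd : Function.Exact f (gammaDiff R M a n) := by
      intro x
      constructor
      · intro hx
        exact ⟨(l ≪≫ₗ l').symm ⟨x, hx⟩, congrArg Subtype.val ((l ≪≫ₗ l').apply_symm_apply ⟨x, hx⟩)⟩
      · rintro ⟨y, rfl⟩
        exact ((l ≪≫ₗ l') y).2
    -- Exactness at `n + j + 1` is the vanishing of local cohomology in a degree above `n`.
    have hd : ∀ j, Function.Exact (gammaDiff R M a (n + j)) (gammaDiff R M a (n + j + 1)) :=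
      fun j => (complexOf_exactAt_succ_iff (gammaDiff_comp a) (n + j)).1
        ((localCohomology_subsingleton_iff a _).1 (hvan _ (by omega)))
    exact ⟨injectiveResolutionOfExact
      (X := fun j => ModuleCat.of R (gamma a (hullTerm R M (n + j)))) hd
      (fun j => (isInjectiveHull_toInjectiveHull R (cosyzygy R M (n + j))).injective_gamma a)
      (localCohomologyModule a n M) f hf hfd,
      isMinimal_injectiveResolutionOfExact _ _ _ _ _ _
        fun j => gammaDiff_ker_isEssential a (n + j),
      fun j => nonempty_gamma_hullTerm_equiv a (n + j)⟩
  -- Through `l` this concerns the torsion of the `n`-th cosyzygy, whose zeroth Bass numbers are the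
  -- `μ^n(p, M)`.
  · rw [LinearEquiv.AssociatedPrimes.eq l, associatedPrimes_gamma]
    simp only [bassNumber_cosyzygy, Nat.add_zero]
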